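/- **Conventions.** Locales are identified with frames; a map of locales $f:X\to Y$ is a frame homomorphism $f^*:Y\to X$ (its inverse image). $f$ is a *surjection* if $f^*$ is injective, and *open* if $f^*$ has a left adjoint $f_!$ (the direct image) with $f_!(x\wedge f^*(y))=f_!(x)\wedge y$. For a locale $A$, an $A$-action on a sup-lattice preserves joins in each variable and satisfies $1_A m=m$, $(a\wedge b)m=a(bm)$ (similarly on the right); left and right actions are written ${}_{a|}m$ and $m_{|a}$. A *groupoid quantale* $Q$ over a locale $A$ is a frame $Q$ with an associative multiplication preserving joins in each variable, a join-preserving involution $*$ with $(xy)^*=y^*x^*$, and left and right $A$-actions such that $({}_{a|}x)_{|b}={}_{a|}(x_{|b})$, $({}_{a|}x)y={}_{a|}(xy)$, $(x_{|a})y=x({}_{a|}y)$, $(xy)_{|a}=x(y_{|a})$, $({}_{a|}x_{|b})^*={}_{b|}x^*{}_{|a}$, $({}_{a|}x)\wedge y={}_{a|}(x\wedge y)$, $y\wedge(x_{|a})=(y\wedge x)_{|a}$; together with a join-preserving support $\varsigma_Q:Q\to A$ with $\varsigma_Q(1_Q)=1_A$, ${}_{\varsigma_Q(x)|}y\le xx^*y$,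 ${}_{\varsigma_Q(x)|}x=x$, $\varsigma_Q({}_{a|}x)=a\wedge\varsigma_Q(x)$, and a frame homomorphism $\upsilon:Q\to A$ with $\upsilon({}_{a|}1_Q)=a=\upsilon(1_{Q|a})$; such that the right adjoint $\mu_*$ of the multiplication $\mu:Q\otimes_AQ\to Q$ preserves joins, $\bigvee_{xy\le a}{}_{\upsilon(x)|}y=a$ and ${}_{\upsilon(a)|}1_Q=\bigvee_{xx^*\le a}x$ for all $a\in Q$. Here $\otimes_A$ is the tensor product of sup-lattices over $A$. Its *groupoid* $\mathcal G(Q)$ is the open localic groupoid with locale of objects $A$, locale of arrows $Q$, and structure maps given by $d^*(a)={}_{a|}1_Q$, $r^*(a)=1_{Q|a}$, $u^*=\upsilon$, $i^*(q)=q^*$, and $m^*=\mu_*$, where $G_2=Q\otimes_AQ$ is the pullback of $r$ and $d$. A *$Q$-locale* is a locale $X$ with an associative action $(q,x)\mapsto q\cdot x$ of $Q$ preserving joins in each variable, a left $A$-action with $({}_{a|}q)\cdot x={}_{a|}(q\cdot x)$, $(q_{|a})\cdot x=q\cdot({}_{a|}x)$, ${}_{a|}(x\wedge y)=({}_{a|}x)\wedge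 y$; a map $\langle-,-\rangle:X\times X\to Q$ preserving joins in the first variable with $\langle q\cdot x,y\rangle=q\langle x,y\rangle$, ${}_{a|}\langle x,1_X\rangle=\langle{}_{a|}x,1_X\rangle$, $\langle x,y\rangle=\langle y,x\rangle^*$; and a monotone $\varsigma_X:X\to A$ with $\varsigma_X(1_X)=1_A$, ${}_{\varsigma_X(x)|}1_X\le\langle x,x\rangle\cdot1_X$, ${}_{\varsigma_X(x)|}x=x$, $\varsigma_X(q\cdot x)\le\varsigma_Q(q)$; such that, for the module action $\alpha:Q\otimes_AX\to X$, $q\otimes x\mapsto q\cdot x$, the right adjoint $\alpha_*(x)=\bigvee_{q\cdot y\le x}q\otimes y$ preserves joins, and $\bigvee_{q\cdot y\le x}{}_{\upsilon(q)|}y=x$ for all $x\in X$. For an open localic groupoid $G$ with multiplication $m:G_2=G_1\times_{G_0}G_1\to G_1$ (pullback of $r$ and $d$), a *$G$-locale* is a triple $(X,\mathfrak a,p)$ with maps of locales $p:X\to G_0$ (the anchor map) and $\mathfrak a:G_1\times_{G_0}X\to X$ (the action; the pullback is that of $r$ and $p$) such that $p\circ\mathfrak a=d\circ\pi_1$, $\mathfrak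 a$ is associative with respect to $m$, and $\mathfrak a\circ\langle u\circ p,\mathrm{id}_X\rangle=\mathrm{id}_X$. It is *fully open* if $p$ is an open surjection. **Theorem.** Let $Q$ be a groupoid quantale over $A$ and let $X$ be a $Q$-locale. Then the locale $Q\otimes_AX$, with the projections $\pi_1^*(q)=q\otimes1_X$ and $\pi_2^*(x)=1_Q\otimes x$, is a pullback $G_1\times_{G_0}X$ for $G=\mathcal G(Q)$, and there are maps of locales $p:X\to A$ and $\mathfrak a:Q\otimes_AX\to X$ such that $(X,\mathfrak a,p)$ is a fully open $\mathcal G(Q)$-locale, the direct image of $p$ is $p_!=\varsigma_X$, and the inverse image of $\mathfrak a$ is $\mathfrak a^*=\alpha_*$, the right adjoint of the module action $\alpha$. -/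

import Mathlib

open CategoryTheory

universe u

namespace OpenGpd

/-! ## Locales and their maps

The category of locales is Mathlib's `Locale`, the opposite of the category of frames. -/

/-- The inverse image homomorphism `f^* : Y → X` of a map of locales `f : X ⟶ Y`. -/
def invImage {X Y : Locale.{u}} (f : X ⟶ Y) : FrameHom Y X :=
  Frm.Hom.hom (Quiver.Hom.unop f)

/-- The map of locales with a given inverse image homomorphism. -/
def mapOf {X Y : Type u} [Order.Frame X] [Order.Frame Y] (f : FrameHom Y X) :
    Locale.of X ⟶ Locale.of Y :=
  Quiver.Hom.op (Frm.ofHom f)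

/-- The inverse image homomorphism of a map into the locale of a frame `Y`. -/
def frameHom {X : Locale.{u}} {Y : Type u} [Order.Frame Y] (f : X ⟶ Locale.of Y) : FrameHom Y X :=
  invImage f

theorem invImage_mapOf {X Y : Type u} [Order.Frame X] [Order.Frame Y] (f : FrameHom Y X) :
    invImage (mapOf f) = f := rfl

theorem invImage_comp {X Y Z : Locale.{u}} (f : X ⟶ Y) (g : Y ⟶ Z) (z : Z) :
    invImage (f ≫ g) z = invImage f (invImage g z) := rfl

theorem invImage_id {X : Locale.{u}} (x : X) : invImage (𝟙 X) x = x := rfl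

theorem map_ext {X Y : Locale.{u}} {f g : X ⟶ Y} (h : ∀ y, invImage f y = invImage g y) : f = g := by
  apply Quiver.Hom.unop_inj
  exact Frm.ext h

theorem mapOf_ext {X : Locale.{u}} {Q : Type u} [Order.Frame Q] {f g : X ⟶ Locale.of Q}
    (h : ∀ q : Q, frameHom f q = frameHom g q) : f = g := map_ext h

/-- `IsDirectImage f s`: the function `s` is the direct image `f_!` of `f`, that is, the left
adjoint of the inverse image `f^*`. -/
def IsDirectImage {X Y : Locale.{u}} (f : X ⟶ Y) (s : X → Y) : Prop :=
  GaloisConnection s (invImage f)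

/-- A map of locales is open if its inverse image has a left adjoint `f_!` (the map is semiopen)
and the Frobenius condition holds. -/
def IsOpenLocaleMap {X Y : Locale.{u}} (f : X ⟶ Y) : Prop :=
  ∃ s : X → Y, IsDirectImage f s ∧ ∀ (a : X) (b : Y), s (a ⊓ invImage f b) = s a ⊓ b

/-- A map of locales is a surjection if its inverse image homomorphism is injective. -/
def IsLocaleSurjection {X Y : Locale.{u}} (f : X ⟶ Y) : Prop :=
  Function.Injective (invImage f)

/-! ## Localic groupoids and their actions -/

/-- An internal groupoid in the category of locales. Here `comp` is the locale `G₂` of composable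
pairs, the pullback of `r` and `d`; the product of `(g, h)` is defined when `r g = d h`.
The associativity law is stated for generalized elements `T ⟶ G₁`; taking for `T` the locale of
composable triples one obtains the usual commutative diagram, and conversely. -/
structure LocalicGroupoid where
  obj : Locale.{u}
  arr : Locale.{u}
  comp : Locale.{u}
  d : arr ⟶ obj
  r : arr ⟶ obj
  unit : obj ⟶ arr
  i : arr ⟶ arr
  π₁ : comp ⟶ arr
  π₂ : comp ⟶ arr
  m : comp ⟶ arr
  isPullback : IsPullback π₁ π₂ r d
  unit_d : unit ≫ d = 𝟙 obj
  unit_r : unit ≫ r = 𝟙 obj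
  m_d : m ≫ d = π₁ ≫ d
  m_r : m ≫ r = π₂ ≫ r
  assoc : ∀ (T : Locale.{u}) (g h k : T ⟶ arr) (gh : g ≫ r = h ≫ d) (hk : h ≫ r = k ≫ d),
    isPullback.lift (isPullback.lift g h gh ≫ m) k
        (by rw [Category.assoc, m_r, IsPullback.lift_snd_assoc, hk]) ≫ m =
      isPullback.lift g (isPullback.lift h k hk ≫ m)
        (by rw [Category.assoc, m_d, IsPullback.lift_fst_assoc, gh]) ≫ m
  unit_mul : isPullback.lift (d ≫ unit) (𝟙 arr)
      (by rw [Category.assoc, unit_r, Category.comp_id, Category.id_comp]) ≫ m = 𝟙 arr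
  mul_unit : isPullback.lift (𝟙 arr) (r ≫ unit)
      (by rw [Category.assoc, unit_d, Category.comp_id, Category.id_comp]) ≫ m = 𝟙 arr
  i_d : i ≫ d = r
  i_r : i ≫ r = d
  mul_inv : isPullback.lift (𝟙 arr) i (by rw [i_d, Category.id_comp]) ≫ m = d ≫ unit
  inv_mul : isPullback.lift i (𝟙 arr) (by rw [i_r, Category.id_comp]) ≫ m = r ≫ unit

/-- A localic groupoid is open if its domain map is open. -/
def LocalicGroupoid.IsOpen (G : LocalicGroupoid.{u}) : Prop :=
  IsOpenLocaleMap G.d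

/-- `IsGLocale G ρ₁ ρ₂ p act`: the locale `P`, with the projections `ρ₁` and `ρ₂`, is the pullback
`G₁ ×_{G₀} X` of `r` and `p`, and `(X, act, p)` is a left `G`-locale, with anchor map `p` and
action `act`. Associativity is again stated for generalized elements. -/
structure IsGLocale (G : LocalicGroupoid.{u}) {X P : Locale.{u}} (ρ₁ : P ⟶ G.arr) (ρ₂ : P ⟶ X)
    (p : X ⟶ G.obj) (act : P ⟶ X) : Prop where
  isPullback : IsPullback ρ₁ ρ₂ G.r p
  act_p : act ≫ p = ρ₁ ≫ G.d
  assoc : ∀ (T : Locale.{u}) (g h : T ⟶ G.arr) (x : T ⟶ X) (gh : g ≫ G.r = h ≫ G.d)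
      (hx : h ≫ G.r = x ≫ p),
    isPullback.lift g (isPullback.lift h x hx ≫ act)
        (by rw [Category.assoc, act_p, IsPullback.lift_fst_assoc, gh]) ≫ act =
      isPullback.lift (G.isPullback.lift g h gh ≫ G.m) x
        (by rw [Category.assoc, G.m_r, IsPullback.lift_snd_assoc, hx]) ≫ act
  unit_act : isPullback.lift (p ≫ G.unit) (𝟙 X)
      (by rw [Category.assoc, G.unit_r, Category.comp_id, Category.id_comp]) ≫ act = 𝟙 X

/-- A fully open `G`-locale: a `G`-locale whose anchor map is an open surjection. -/
structure IsFullyOpenGLocale (G : LocalicGroupoid.{u}) {X P : Locale.{u}} (ρ₁ : P ⟶ G.arr)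
    (ρ₂ : P ⟶ X) (p : X ⟶ G.obj) (act : P ⟶ X) : Prop
    extends IsGLocale G ρ₁ ρ₂ p act where
  isOpen : IsOpenLocaleMap p
  surjective : IsLocaleSurjection p

/-! ## Modules over a locale and their tensor products -/

/-- A unital left `A`-module structure on the sup-lattice `M`, for a locale `A`
(regarded as a quantale with multiplication `⊓` and unit `⊤`). -/
class LeftAModule (A M : Type u) [Order.Frame A] [CompleteLattice M] where
  lres : A → M → M
  top_lres : ∀ m, lres ⊤ m = m
  inf_lres : ∀ a b m, lres (a ⊓ b) m = lres a (lres b m)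
  sSup_lres : ∀ (S : Set A) m, lres (sSup S) m = ⨆ a ∈ S, lres a m
  lres_sSup : ∀ a (S : Set M), lres a (sSup S) = ⨆ m ∈ S, lres a m

/-- A unital right `A`-module structure on the sup-lattice `M`. -/
class RightAModule (A M : Type u) [Order.Frame A] [CompleteLattice M] where
  rres : M → A → M
  rres_top : ∀ m, rres m ⊤ = m
  rres_inf : ∀ m a b, rres m (a ⊓ b) = rres (rres m a) b
  rres_sSup : ∀ m (S : Set A), rres m (sSup S) = ⨆ a ∈ S, rres m a
  sSup_rres : ∀ (S : Set M) a, rres (sSup S) a = ⨆ m ∈ S, rres m a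

infixr:73 " ⇀ " => LeftAModule.lres
infixl:73 " ↼ " => RightAModule.rres

/-- The compatibility of a left `A`-action on a locale with binary meets. -/
class LeftLocalic (A M : Type u) [Order.Frame A] [Order.Frame M] [LeftAModule A M] : Prop where
  lres_inf : ∀ (a : A) (x y : M), (a ⇀ x) ⊓ y = a ⇀ (x ⊓ y)

/-- The compatibility of a right `A`-action on a locale with binary meets. -/
class RightLocalic (A M : Type u) [Order.Frame A] [Order.Frame M] [RightAModule A M] : Prop where
  inf_rres : ∀ (a : A) (x y : M), y ⊓ (x ↼ a) = (y ⊓ x) ↼ a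

/-- The tensor product `M ⊗_A N` of sup-lattices, concretely: its elements are the subsets of
`M × N` that are closed under joins in each variable and under the identification of
`(m ↼ a, n)` with `(m, a ⇀ n)`, ordered by inclusion. -/
@[ext]
structure Tensor (A M N : Type u) [Order.Frame A] [CompleteLattice M] [CompleteLattice N]
    [RightAModule A M] [LeftAModule A N] where
  carrier : Set (M × N)
  lower : ∀ {m m' n n'}, m' ≤ m → n' ≤ n → (m, n) ∈ carrier → (m', n') ∈ carrier
  sSup_left : ∀ (S : Set M) (n : N), (∀ m ∈ S, (m, n) ∈ carrier) → (sSup S, n) ∈ carrier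
  sSup_right : ∀ (m : M) (S : Set N), (∀ n ∈ S, (m, n) ∈ carrier) → (m, sSup S) ∈ carrier
  balanced : ∀ (m : M) (a : A) (n : N), (m ↼ a, n) ∈ carrier ↔ (m, a ⇀ n) ∈ carrier

namespace Tensor

section SupLattice

variable {A M N : Type u} [Order.Frame A] [CompleteLattice M] [CompleteLattice N]
  [RightAModule A M] [LeftAModule A N]

instance : SetLike (Tensor A M N) (M × N) where
  coe D := D.carrier
  coe_injective _ _ h := Tensor.ext h

instance : PartialOrder (Tensor A M N) := PartialOrder.ofSetLike _ _

instance : InfSet (Tensor A M N) where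
  sInf 𝒮 :=
    { carrier := {x | ∀ D ∈ 𝒮, x ∈ D}
      lower := fun h₁ h₂ h D hD => D.lower h₁ h₂ (h D hD)
      sSup_left := fun S n h D hD => D.sSup_left S n fun m hm => h m hm D hD
      sSup_right := fun m S h D hD => D.sSup_right m S fun n hn => h n hn D hD
      balanced := fun m a n => forall₂_congr fun D _ => D.balanced m a n }

instance : CompleteLattice (Tensor A M N) :=
  { completeLatticeOfInf (Tensor A M N) (fun _ =>
      ⟨fun _ hD _ hx => hx _ hD, fun _ hE _ hx _ hD => hE hD hx⟩) with
    inf := fun D E =>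
      { carrier := {x | x ∈ D ∧ x ∈ E}
        lower := fun h₁ h₂ h => ⟨D.lower h₁ h₂ h.1, E.lower h₁ h₂ h.2⟩
        sSup_left := fun S n h =>
          ⟨D.sSup_left S n fun m hm => (h m hm).1, E.sSup_left S n fun m hm => (h m hm).2⟩
        sSup_right := fun m S h =>
          ⟨D.sSup_right m S fun n hn => (h n hn).1, E.sSup_right m S fun n hn => (h n hn).2⟩
        balanced := fun m a n => and_congr (D.balanced m a n) (E.balanced m a n) }
    inf_le_left := fun _ _ _ h => h.1
    inf_le_right := fun _ _ _ h => h.2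
    le_inf := fun _ _ _ h₁ h₂ _ h => ⟨h₁ h, h₂ h⟩
    top := ⟨Set.univ, fun _ _ _ => trivial, fun _ _ _ => trivial, fun _ _ _ => trivial,
      fun _ _ _ => Iff.rfl⟩
    le_top := fun _ _ _ => trivial }

theorem mem_inf {D E : Tensor A M N} {x : M × N} : x ∈ D ⊓ E ↔ x ∈ D ∧ x ∈ E := Iff.rfl

theorem mem_top (x : M × N) : x ∈ (⊤ : Tensor A M N) := trivial

/-- The pure tensor `m ⊗ n`. -/
def tmul (A : Type u) {M N : Type u} [Order.Frame A] [CompleteLattice M] [CompleteLattice N]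
    [RightAModule A M] [LeftAModule A N] (m : M) (n : N) : Tensor A M N :=
  sInf {D | (m, n) ∈ D}

theorem tmul_le {m : M} {n : N} {D : Tensor A M N} : tmul A m n ≤ D ↔ (m, n) ∈ D :=
  ⟨fun h => h fun _ hE => hE, fun h => sInf_le h⟩

theorem mem_tmul (m : M) (n : N) : (m, n) ∈ tmul A m n := tmul_le.1 le_rfl

theorem eq_sSup_tmul (D : Tensor A M N) : D = ⨆ x ∈ D, tmul A x.1 x.2 :=
  le_antisymm
    (fun x hx => tmul_le.1 (le_iSup₂ (f := fun (x : M × N) (_ : x ∈ D) => tmul A x.1 x.2) x hx))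
    (iSup₂_le fun _ hx => tmul_le.2 hx)

/-- Balanced maps `M × N → L` that preserve joins in each variable. -/
structure IsBimorphism (A : Type u) {M N L : Type u} [Order.Frame A] [CompleteLattice M]
    [CompleteLattice N] [RightAModule A M] [LeftAModule A N] [CompleteLattice L]
    (f : M → N → L) : Prop where
  sSup_left : ∀ (S : Set M) n, f (sSup S) n = ⨆ m ∈ S, f m n
  sSup_right : ∀ m (S : Set N), f m (sSup S) = ⨆ n ∈ S, f m n
  balanced : ∀ m (a : A) n, f (m ↼ a) n = f m (a ⇀ n)

variable {L : Type u} [CompleteLattice L]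

/-- The map `M ⊗_A N → L` that a bimorphism `f` induces, `m ⊗ n ↦ f m n`. -/
def lift (f : M → N → L) (D : Tensor A M N) : L :=
  ⨆ x ∈ D, f x.1 x.2

/-- The map `L → M ⊗_A N`, `c ↦ ⋁ {m ⊗ n | f m n ≤ c}`. -/
def adj (A : Type u) {M N L : Type u} [Order.Frame A] [CompleteLattice M]
    [CompleteLattice N] [RightAModule A M] [LeftAModule A N] [CompleteLattice L]
    (f : M → N → L) (c : L) : Tensor A M N :=
  sSup {t | ∃ m n, f m n ≤ c ∧ t = tmul A m n}


namespace IsBimorphism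

variable {f : M → N → L}

theorem mono (hf : IsBimorphism A f) {m m' n n'} (h₁ : m' ≤ m) (h₂ : n' ≤ n) :
    f m' n' ≤ f m n := by
  have e1 : f m n' = ⨆ k ∈ ({m', m} : Set M), f k n' := by
    rw [← hf.sSup_left, sSup_pair, sup_eq_right.2 h₁]
  have e2 : f m n = ⨆ k ∈ ({n', n} : Set N), f m k := by
    rw [← hf.sSup_right, sSup_pair, sup_eq_right.2 h₂]
  calc f m' n' ≤ f m n' := by
        rw [e1]; exact le_iSup₂ (f := fun k (_ : k ∈ ({m', m} : Set M)) => f k n') m' (by simp)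
    _ ≤ f m n := by
        rw [e2]; exact le_iSup₂ (f := fun k (_ : k ∈ ({n', n} : Set N)) => f m k) n' (by simp)

theorem mem_adj (hf : IsBimorphism A f) {m : M} {n : N} {c : L} :
    (m, n) ∈ adj A f c ↔ f m n ≤ c := by
  constructor
  · intro h
    let E : Tensor A M N :=
      { carrier := {x | f x.1 x.2 ≤ c}
        lower := fun h₁ h₂ h => (hf.mono h₁ h₂).trans h
        sSup_left := fun S n h => by
          simp only [Set.mem_ofPred_eq, hf.sSup_left] at h ⊢
          exact iSup₂_le h
        sSup_right := fun m S h => by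
          simp only [Set.mem_ofPred_eq, hf.sSup_right] at h ⊢
          exact iSup₂_le h
        balanced := fun m a n => by simp only [Set.mem_ofPred_eq, hf.balanced] }
    have hE : adj A f c ≤ E := sSup_le (by
      rintro _ ⟨m, n, h, rfl⟩
      exact tmul_le.2 h)
    exact hE h
  · intro h
    exact tmul_le.1 (le_sSup ⟨m, n, h, rfl⟩)

/-- `adj A f` is the right adjoint of the map induced by `f`. -/
theorem gc (hf : IsBimorphism A f) : GaloisConnection (lift (A := A) f) (adj A f) := by
  intro D c
  constructor
  · intro h x hx
    exact hf.mem_adj.2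
      ((le_iSup₂ (f := fun (x : M × N) (_ : x ∈ D) => f x.1 x.2) x hx).trans h)
  · intro h
    exact iSup₂_le fun x hx => hf.mem_adj.1 (h hx)

theorem lift_tmul (hf : IsBimorphism A f) (m : M) (n : N) : lift f (tmul A m n) = f m n :=
  eq_of_forall_ge_iff fun c => by rw [hf.gc.le_iff_le, tmul_le, hf.mem_adj]

/-- The universal property of the tensor product of sup-lattices over `A`. -/
theorem existsUnique_lift (hf : IsBimorphism A f) :
    ∃! φ : sSupHom (Tensor A M N) L, ∀ m n, φ (tmul A m n) = f m n := by
  refine ⟨⟨lift f, fun S => by rw [hf.gc.l_sSup, sSup_image]⟩, hf.lift_tmul, ?_⟩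
  intro φ hφ
  ext D
  change φ D = lift f D
  conv_lhs => rw [eq_sSup_tmul D]
  simp only [map_iSup, hφ]
  rfl

end IsBimorphism

/-- The canonical map `M × N → M ⊗_A N` is a bimorphism. -/
theorem isBimorphism_tmul :
    IsBimorphism A (fun (m : M) (n : N) => tmul A m n) where
  sSup_left S n := le_antisymm
    (tmul_le.2 (Tensor.sSup_left _ S n fun _ hm => tmul_le.1
      (le_iSup₂ (f := fun m (_ : m ∈ S) => tmul A m n) _ hm)))
    (iSup₂_le fun _ hm => tmul_le.2
      (Tensor.lower _ (le_sSup hm) le_rfl (mem_tmul _ _)))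
  sSup_right m S := le_antisymm
    (tmul_le.2 (Tensor.sSup_right _ m S fun _ hn => tmul_le.1
      (le_iSup₂ (f := fun n (_ : n ∈ S) => tmul A m n) _ hn)))
    (iSup₂_le fun _ hn => tmul_le.2
      (Tensor.lower _ le_rfl (le_sSup hn) (mem_tmul _ _)))
  balanced _ _ _ := le_antisymm
    (tmul_le.2 ((Tensor.balanced _ _ _ _).2 (mem_tmul _ _)))
    (tmul_le.2 ((Tensor.balanced _ _ _ _).1 (mem_tmul _ _)))

end SupLattice

section Locale

variable {A M N : Type u} [Order.Frame A] [Order.Frame M] [Order.Frame N]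
  [RightAModule A M] [LeftAModule A N] [RightLocalic A M] [LeftLocalic A N]

/-- The elements `x` of `M × N` whose meet with `y` lies in `C`. -/
def slice (y : M × N) (C : Tensor A M N) : Tensor A M N where
  carrier := {x | (x.1 ⊓ y.1, x.2 ⊓ y.2) ∈ C}
  lower h₁ h₂ h := C.lower (inf_le_inf_right _ h₁) (inf_le_inf_right _ h₂) h
  sSup_left S n h := by
    change (sSup S ⊓ y.1, n ⊓ y.2) ∈ C
    rw [sSup_inf_eq, ← sSup_image]
    apply C.sSup_left
    rintro _ ⟨m, hm, rfl⟩
    exact h m hm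
  sSup_right m S h := by
    change (m ⊓ y.1, sSup S ⊓ y.2) ∈ C
    rw [sSup_inf_eq, ← sSup_image]
    apply C.sSup_right
    rintro _ ⟨n, hn, rfl⟩
    exact h n hn
  balanced m a n := by
    change ((m ↼ a) ⊓ y.1, n ⊓ y.2) ∈ C ↔ (m ⊓ y.1, (a ⇀ n) ⊓ y.2) ∈ C
    rw [LeftLocalic.lres_inf, inf_comm, RightLocalic.inf_rres, inf_comm y.1]
    exact C.balanced _ _ _

/-- The Heyting implication of `M ⊗_A N`. -/
def imp (D C : Tensor A M N) : Tensor A M N :=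
  sInf {E | ∃ y ∈ D, E = slice y C}

theorem mem_imp {D C : Tensor A M N} {x : M × N} :
    x ∈ imp D C ↔ ∀ y ∈ D, (x.1 ⊓ y.1, x.2 ⊓ y.2) ∈ C :=
  ⟨fun h y hy => h _ ⟨y, hy, rfl⟩, by rintro h _ ⟨y, hy, rfl⟩; exact h y hy⟩

theorem le_imp_iff (E D C : Tensor A M N) : E ≤ imp D C ↔ E ⊓ D ≤ C := by
  constructor
  · intro h x hx
    have := mem_imp.1 (h hx.1) x hx.2
    rwa [inf_idem, inf_idem] at this
  · intro h x hx
    exact mem_imp.2 fun y hy =>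
      h ⟨E.lower inf_le_left inf_le_left hx, D.lower inf_le_right inf_le_right hy⟩

/-- If `M` and `N` are locales and the actions of `A` are compatible with meets, then `M ⊗_A N` is
a locale. -/
instance : Order.Frame (Tensor A M N) :=
  { (inferInstance : CompleteLattice (Tensor A M N)) with
    himp := imp
    le_himp_iff := fun E D C => le_imp_iff E D C
    compl := fun D => imp D ⊥
    himp_bot := fun _ => rfl }

theorem tmul_inf_tmul (m m' : M) (n n' : N) :
    tmul A m n ⊓ tmul A m' n' = tmul A (m ⊓ m') (n ⊓ n') := by
  apply le_antisymm
  · rw [← le_imp_iff, tmul_le, mem_imp]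
    intro y hy
    have h : tmul A m' n' ≤ slice (m, n) (tmul A (m ⊓ m') (n ⊓ n')) := by
      rw [tmul_le]
      change (m' ⊓ m, n' ⊓ n) ∈ tmul A (m ⊓ m') (n ⊓ n')
      rw [inf_comm m', inf_comm n']
      exact mem_tmul _ _
    have : (y.1 ⊓ m, y.2 ⊓ n) ∈ tmul A (m ⊓ m') (n ⊓ n') := h hy
    rwa [inf_comm y.1, inf_comm y.2] at this
  · exact tmul_le.2 ⟨Tensor.lower _ inf_le_left inf_le_left (mem_tmul _ _),
      Tensor.lower _ inf_le_right inf_le_right (mem_tmul _ _)⟩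

theorem tmul_top_top {A M N : Type u} [Order.Frame A] [CompleteLattice M] [CompleteLattice N]
    [RightAModule A M] [LeftAModule A N] : tmul A (⊤ : M) (⊤ : N) = ⊤ :=
  top_le_iff.1 fun _ _ => Tensor.lower _ le_top le_top (mem_tmul _ _)

/-- The frame homomorphism `m ↦ m ⊗ 1`. -/
def inl (A M N : Type u) [Order.Frame A] [Order.Frame M] [Order.Frame N]
    [RightAModule A M] [LeftAModule A N] [RightLocalic A M] [LeftLocalic A N] :
    FrameHom M (Tensor A M N) where
  toFun m := tmul A m ⊤
  map_inf' m m' := by rw [tmul_inf_tmul, inf_idem]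
  map_top' := tmul_top_top
  map_sSup' S := by rw [isBimorphism_tmul.sSup_left, sSup_image]

/-- The frame homomorphism `n ↦ 1 ⊗ n`. -/
def inr (A M N : Type u) [Order.Frame A] [Order.Frame M] [Order.Frame N]
    [RightAModule A M] [LeftAModule A N] [RightLocalic A M] [LeftLocalic A N] :
    FrameHom N (Tensor A M N) where
  toFun n := tmul A ⊤ n
  map_inf' n n' := by rw [tmul_inf_tmul, inf_idem]
  map_top' := tmul_top_top
  map_sSup' S := by rw [isBimorphism_tmul.sSup_right, sSup_image]

/-- `M ⊗_A N`, as a locale. -/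
abbrev prod (A M N : Type u) [Order.Frame A] [Order.Frame M] [Order.Frame N]
    [RightAModule A M] [LeftAModule A N] [RightLocalic A M] [LeftLocalic A N] : Locale.{u} :=
  Locale.of (Tensor A M N)

/-- The first projection of the locale `M ⊗_A N`. -/
def proj₁ (A M N : Type u) [Order.Frame A] [Order.Frame M] [Order.Frame N]
    [RightAModule A M] [LeftAModule A N] [RightLocalic A M] [LeftLocalic A N] :
    prod A M N ⟶ Locale.of M :=
  mapOf (inl A M N)

/-- The second projection of the locale `M ⊗_A N`. -/
def proj₂ (A M N : Type u) [Order.Frame A] [Order.Frame M] [Order.Frame N]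
    [RightAModule A M] [LeftAModule A N] [RightLocalic A M] [LeftLocalic A N] :
    prod A M N ⟶ Locale.of N :=
  mapOf (inr A M N)

theorem isBimorphism_inf {T : Type u} [Order.Frame T] (g : FrameHom M T) (h : FrameHom N T)
    (w : ∀ a : A, g (⊤ ↼ a) = h (a ⇀ ⊤)) : IsBimorphism A (fun m n => g m ⊓ h n) where
  sSup_left S n := by rw [map_sSup, sSup_inf_eq, iSup_image]
  sSup_right m S := by rw [map_sSup, inf_sSup_eq, iSup_image]
  balanced m a n := by
    have e1 : m ↼ a = m ⊓ (⊤ ↼ a) := by rw [RightLocalic.inf_rres, inf_top_eq]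
    have e2 : a ⇀ n = (a ⇀ ⊤) ⊓ n := by rw [LeftLocalic.lres_inf, top_inf_eq]
    rw [e1, e2, map_inf, map_inf, w, inf_assoc]

/-- The frame homomorphism on `M ⊗_A N` induced by a pair of frame homomorphisms. -/
def pair {T : Type u} [Order.Frame T] (g : FrameHom M T) (h : FrameHom N T)
    (w : ∀ a : A, g (⊤ ↼ a) = h (a ⇀ ⊤)) : FrameHom (Tensor A M N) T where
  toFun := lift fun m n => g m ⊓ h n
  map_sSup' S := by rw [(isBimorphism_inf g h w).gc.l_sSup, sSup_image]
  map_top' := by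
    rw [← tmul_top_top, (isBimorphism_inf g h w).lift_tmul, map_top, map_top, inf_top_eq]
  map_inf' D E := by
    apply le_antisymm
    · exact (isBimorphism_inf g h w).gc.monotone_l.map_inf_le D E
    · unfold lift
      simp only [iSup_inf_eq, inf_iSup_eq]
      refine iSup₂_le fun x hx => iSup₂_le fun y hy => ?_
      have hxy : (y.1 ⊓ x.1, y.2 ⊓ x.2) ∈ D ⊓ E := by
        constructor <;> first
          | exact Tensor.lower _ inf_le_left inf_le_left (by assumption)
          | exact Tensor.lower _ inf_le_right inf_le_right (by assumption)
      refine le_trans (le_of_eq ?_) (le_iSup₂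
        (f := fun (z : M × N) (_ : z ∈ D ⊓ E) => g z.1 ⊓ h z.2) _ hxy)
      rw [map_inf, map_inf]
      exact inf_inf_inf_comm _ _ _ _

theorem pair_apply {T : Type u} [Order.Frame T] (g : FrameHom M T) (h : FrameHom N T)
    (w : ∀ a : A, g (⊤ ↼ a) = h (a ⇀ ⊤)) (D : Tensor A M N) :
    pair g h w D = ⨆ x ∈ D, g x.1 ⊓ h x.2 := rfl

theorem pair_tmul {T : Type u} [Order.Frame T] (g : FrameHom M T) (h : FrameHom N T)
    (w : ∀ a : A, g (⊤ ↼ a) = h (a ⇀ ⊤)) (m : M) (n : N) :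
    pair g h w (tmul A m n) = g m ⊓ h n :=
  (isBimorphism_inf g h w).lift_tmul m n

theorem hom_eq_pair {T : Type u} [Order.Frame T] (g : FrameHom M T) (h : FrameHom N T)
    (k : FrameHom (Tensor A M N) T)
    (hg : ∀ m, k (inl A M N m) = g m) (hh : ∀ n, k (inr A M N n) = h n) (D : Tensor A M N) :
    k D = ⨆ x ∈ D, g x.1 ⊓ h x.2 := by
  conv_lhs => rw [eq_sSup_tmul D]
  rw [map_iSup]
  simp only [map_iSup]
  refine iSup_congr fun x => iSup_congr fun _ => ?_
  have : tmul A x.1 x.2 = inl A M N x.1 ⊓ inr A M N x.2 := by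
    change _ = tmul A x.1 ⊤ ⊓ tmul A ⊤ x.2
    rw [tmul_inf_tmul, inf_top_eq, top_inf_eq]
  rw [this, map_inf, hg, hh]

theorem frameHom_eq {A M N : Type u} [Order.Frame A] [Order.Frame M] [Order.Frame N]
    {T : Locale.{u}} {f : Locale.of M ⟶ Locale.of A}
    {p : Locale.of N ⟶ Locale.of A} {r : FrameHom A M} {q : FrameHom A N} (hf : f = mapOf r)
    (hp : p = mapOf q) (g : T ⟶ Locale.of M) (k : T ⟶ Locale.of N) (w : g ≫ f = k ≫ p) (a : A) :
    frameHom g (r a) = frameHom k (q a) := by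
  subst hf hp
  exact congrArg (fun φ : T ⟶ Locale.of A => frameHom φ a) w

/-- `M ⊗_A N` is the pullback of locales of `M` and `N` over `A`, if the maps to `A` have the
inverse images `a ↦ 1 ↼ a` and `a ↦ a ⇀ 1`. -/
theorem isPullback {r : FrameHom A M} {q : FrameHom A N}
    (hr : ∀ a : A, r a = (⊤ : M) ↼ a) (hq : ∀ a : A, q a = a ⇀ (⊤ : N)) :
    IsPullback (proj₁ A M N) (proj₂ A M N) (mapOf r) (mapOf q) := by
  have key : ∀ (T : Locale.{u}) (g : T ⟶ Locale.of M) (k : T ⟶ Locale.of N),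
      g ≫ mapOf r = k ≫ mapOf q →
      ∀ a : A, frameHom g ((⊤ : M) ↼ a) = frameHom k (a ⇀ (⊤ : N)) := by
    intro T g k w a
    rw [← hr, ← hq]
    exact frameHom_eq rfl rfl g k w a
  refine ⟨⟨map_ext fun (a : A) => ?_⟩, ⟨Limits.PullbackCone.IsLimit.mk _
    (fun s => Quiver.Hom.op (Frm.ofHom (pair (frameHom s.fst)
      (frameHom s.snd) (key _ _ _ s.condition))))
    (fun s => ?_) (fun s => ?_) (fun s k h₁ h₂ => ?_)⟩⟩
  · change inl A M N (r a) = inr A M N (q a)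
    rw [hr, hq]
    exact isBimorphism_tmul.balanced _ _ _
  · refine map_ext fun (m : M) => ?_
    refine (pair_tmul _ _ (key _ _ _ s.condition) m ⊤).trans ?_
    exact (congrArg _ (map_top _)).trans (inf_top_eq _)
  · refine map_ext fun (n : N) => ?_
    refine (pair_tmul _ _ (key _ _ _ s.condition) ⊤ n).trans ?_
    exact (congrArg (· ⊓ _) (map_top _)).trans (top_inf_eq _)
  · refine map_ext fun (D : Tensor A M N) => ?_
    refine hom_eq_pair (frameHom s.fst) (frameHom s.snd) (frameHom k) (fun m => ?_) (fun n => ?_) D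
    · rw [← h₁]; rfl
    · rw [← h₂]; rfl

theorem frameHom_lift {f : Locale.of M ⟶ Locale.of A} {p : Locale.of N ⟶ Locale.of A}
    (h : IsPullback (proj₁ A M N) (proj₂ A M N) f p) {T : Locale.{u}}
    (g : T ⟶ Locale.of M) (k : T ⟶ Locale.of N) (w : g ≫ f = k ≫ p) (D : Tensor A M N) :
    frameHom (h.lift g k w) D = ⨆ x ∈ D, frameHom g x.1 ⊓ frameHom k x.2 := by
  refine hom_eq_pair (frameHom g) (frameHom k) (frameHom (h.lift g k w))
    (fun m => ?_) (fun n => ?_) D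
  · conv_rhs => rw [← h.lift_fst g k w]
    rfl
  · conv_rhs => rw [← h.lift_snd g k w]
    rfl

theorem frameHom_lift_comp {f : Locale.of M ⟶ Locale.of A} {p : Locale.of N ⟶ Locale.of A}
    (h : IsPullback (proj₁ A M N) (proj₂ A M N) f p) {T : Locale.{u}} {L : Type u} [Order.Frame L]
    (g : T ⟶ Locale.of M) (k : T ⟶ Locale.of N) (w : g ≫ f = k ≫ p)
    {act : M → N → L} (hact : IsBimorphism A act) {μ : FrameHom L (Tensor A M N)}
    (hμ : ∀ c, μ c = adj A act c) (c : L) :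
    frameHom (h.lift g k w ≫ mapOf μ) c =
      ⨆ (m : M) (n : N) (_ : act m n ≤ c), frameHom g m ⊓ frameHom k n := by
  have e : frameHom (h.lift g k w ≫ mapOf μ) c = frameHom (h.lift g k w) (μ c) := rfl
  rw [e, frameHom_lift, hμ, iSup_prod]
  simp only [hact.mem_adj]

end Locale

end Tensor

/-- The frame homomorphism `A → M`, `a ↦ a ⇀ 1`. -/
def lresTop (A M : Type u) [Order.Frame A] [Order.Frame M] [LeftAModule A M] [LeftLocalic A M] :
    FrameHom A M where
  toFun a := a ⇀ ⊤
  map_inf' a b := by rw [LeftLocalic.lres_inf, top_inf_eq, LeftAModule.inf_lres]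
  map_top' := LeftAModule.top_lres _
  map_sSup' S := by rw [LeftAModule.sSup_lres, sSup_image]

/-- The frame homomorphism `A → M`, `a ↦ 1 ↼ a`. -/
def topRres (A M : Type u) [Order.Frame A] [Order.Frame M] [RightAModule A M] [RightLocalic A M] :
    FrameHom A M where
  toFun a := ⊤ ↼ a
  map_inf' a b := by rw [RightLocalic.inf_rres, inf_top_eq, RightAModule.rres_inf]
  map_top' := RightAModule.rres_top _
  map_sSup' S := by rw [RightAModule.rres_sSup, sSup_image]

/-! ## Groupoid quantales -/

/-- A based quantale: an involutive quantale `Q` (Mathlib's `Semigroup`, `IsQuantale`, `StarMul`)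
with the structure of an involutive `A`-`A`-quantale for a locale `A`. -/
class BasedQuantale (A Q : Type u) [Order.Frame A] [CompleteLattice Q] [Semigroup Q] [IsQuantale Q]
    [StarMul Q] extends LeftAModule A Q, RightAModule A Q where
  lres_rres : ∀ (a b : A) (x : Q), (a ⇀ x) ↼ b = a ⇀ (x ↼ b)
  lres_mul : ∀ (a : A) (x y : Q), (a ⇀ x) * y = a ⇀ (x * y)
  rres_mul : ∀ (a : A) (x y : Q), (x ↼ a) * y = x * (a ⇀ y)
  mul_rres : ∀ (a : A) (x y : Q), (x * y) ↼ a = x * (y ↼ a)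
  star_sSup : ∀ S : Set Q, star (sSup S) = ⨆ x ∈ S, star x
  star_lres_rres : ∀ (a b : A) (x : Q), star (a ⇀ (x ↼ b)) = b ⇀ (star x ↼ a)

/-- A supported quantale, with support `spp : Q → A`. -/
class SupportedQuantale (A Q : Type u) [Order.Frame A] [CompleteLattice Q] [Semigroup Q]
    [IsQuantale Q] [StarMul Q] extends BasedQuantale A Q where
  spp : Q → A
  spp_sSup : ∀ S : Set Q, spp (sSup S) = ⨆ x ∈ S, spp x
  spp_top : spp ⊤ = ⊤
  spp_lres_le : ∀ x y : Q, spp x ⇀ y ≤ x * star x * y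
  spp_lres_self : ∀ x : Q, spp x ⇀ x = x

/-- A groupoid quantale: a multiplicative, equivariantly supported, reflexive quantal frame
satisfying the unit laws and the inverse laws. The parents `LeftLocalic` and `RightLocalic`,
together with the frame structure of `Q`, make the based quantale `Q` a quantal frame. -/
class GroupoidQuantale (A Q : Type u) [Order.Frame A] [Order.Frame Q] [Semigroup Q] [IsQuantale Q]
    [StarMul Q] extends SupportedQuantale A Q, LeftLocalic A Q, RightLocalic A Q where
  /-- equivariance of the support -/
  spp_lres : ∀ (a : A) (x : Q), spp (a ⇀ x) = a ⊓ spp x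
  /-- the frame homomorphism that makes `Q` reflexive -/
  υ : FrameHom Q A
  υ_lres_top : ∀ a : A, υ (a ⇀ (⊤ : Q)) = a
  υ_top_rres : ∀ a : A, υ ((⊤ : Q) ↼ a) = a
  /-- multiplicativity: the right adjoint of the multiplication `Q ⊗_A Q → Q` preserves joins -/
  multiplicative : ∀ S : Set Q,
    Tensor.adj A (fun x y : Q => x * y) (sSup S) = ⨆ a ∈ S, Tensor.adj A (fun x y : Q => x * y) a
  unit_laws : ∀ a : Q, ⨆ (x : Q) (y : Q) (_ : x * y ≤ a), υ x ⇀ y = a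
  inverse_laws : ∀ a : Q, υ a ⇀ (⊤ : Q) = ⨆ (x : Q) (_ : x * star x ≤ a), x

section GroupoidOf

open Tensor SupportedQuantale GroupoidQuantale BasedQuantale LeftAModule RightAModule LeftLocalic
  RightLocalic

variable {A Q : Type u} [Order.Frame A] [Order.Frame Q] [Semigroup Q] [IsQuantale Q] [StarMul Q]
  [GroupoidQuantale A Q]

theorem isBimorphism_mul (A Q : Type u) [Order.Frame A] [Order.Frame Q] [Semigroup Q]
    [IsQuantale Q] [StarMul Q] [GroupoidQuantale A Q] :
    IsBimorphism A (fun x y : Q => x * y) where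
  sSup_left _ _ := sSup_mul_distrib
  sSup_right _ _ := mul_sSup_distrib
  balanced x a y := rres_mul a x y

theorem star_mono {x y : Q} (A : Type u) [Order.Frame A] [GroupoidQuantale A Q] (h : x ≤ y) :
    star x ≤ star y := by
  have : star y = ⨆ z ∈ ({x, y} : Set Q), star z := by
    rw [← star_sSup (A := A), sSup_pair, sup_eq_right.2 h]
  rw [this]
  exact le_iSup₂ (f := fun z (_ : z ∈ ({x, y} : Set Q)) => star z) x (by simp)

/-- The involution of `Q` as a frame homomorphism. -/
def starHom (A Q : Type u) [Order.Frame A] [Order.Frame Q] [Semigroup Q] [IsQuantale Q] [StarMul Q]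
    [GroupoidQuantale A Q] : FrameHom Q Q where
  toFun := star
  map_inf' x y := by
    apply le_antisymm
    · exact le_inf (star_mono A inf_le_left) (star_mono A inf_le_right)
    · have : star (star x ⊓ star y) ≤ x ⊓ y := le_inf
        ((star_mono A inf_le_left).trans (star_star x).le)
        ((star_mono A inf_le_right).trans (star_star y).le)
      have h := star_mono A this
      rwa [star_star] at h
  map_top' := by
    apply top_le_iff.1
    have h := star_mono A (le_top (a := star (⊤ : Q)))
    rwa [star_star] at h
  map_sSup' S := by rw [star_sSup (A := A), sSup_image]

/-- The right adjoint of the multiplication `Q ⊗_A Q → Q`, as a frame homomorphism. -/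
def comulHom (A Q : Type u) [Order.Frame A] [Order.Frame Q] [Semigroup Q] [IsQuantale Q]
    [StarMul Q] [GroupoidQuantale A Q] : FrameHom Q (Tensor A Q Q) where
  toFun := adj A fun x y : Q => x * y
  map_inf' _ _ := (isBimorphism_mul A Q).gc.u_inf
  map_top' := (isBimorphism_mul A Q).gc.u_top
  map_sSup' S := by rw [multiplicative, sSup_image]

theorem lres_mono {A M : Type u} [Order.Frame A] [CompleteLattice M] [LeftAModule A M]
    {a b : A} {m n : M} (h₁ : a ≤ b) (h₂ : m ≤ n) : a ⇀ m ≤ b ⇀ n := by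
  have e1 : b ⇀ m = ⨆ c ∈ ({a, b} : Set A), c ⇀ m := by
    rw [← sSup_lres, sSup_pair, sup_eq_right.2 h₁]
  have e2 : b ⇀ n = ⨆ k ∈ ({m, n} : Set M), b ⇀ k := by
    rw [← lres_sSup, sSup_pair, sup_eq_right.2 h₂]
  calc a ⇀ m ≤ b ⇀ m := by
        rw [e1]; exact le_iSup₂ (f := fun k (_ : k ∈ ({a, b} : Set A)) => k ⇀ m) a (by simp)
    _ ≤ b ⇀ n := by
        rw [e2]; exact le_iSup₂ (f := fun k (_ : k ∈ ({m, n} : Set M)) => b ⇀ k) m (by simp)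

theorem lres_top_inf {A M : Type u} [Order.Frame A] [Order.Frame M] [LeftAModule A M]
    [LeftLocalic A M] (a : A) (m : M) : (a ⇀ ⊤) ⊓ m = a ⇀ m := by
  rw [lres_inf, top_inf_eq]

theorem inf_top_rres {A M : Type u} [Order.Frame A] [Order.Frame M] [RightAModule A M]
    [RightLocalic A M] (a : A) (m : M) : m ⊓ (⊤ ↼ a) = m ↼ a := by
  rw [inf_rres, inf_top_eq]

theorem spp_mono {x y : Q} (A : Type u) [Order.Frame A] [GroupoidQuantale A Q] (h : x ≤ y) :
    (spp x : A) ≤ spp y := by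
  have : (spp y : A) = ⨆ z ∈ ({x, y} : Set Q), spp z := by
    rw [← spp_sSup, sSup_pair, sup_eq_right.2 h]
  rw [this]
  exact le_iSup₂ (f := fun z (_ : z ∈ ({x, y} : Set Q)) => (spp z : A)) x (by simp)

theorem le_lres_top_iff (x : Q) (a : A) : x ≤ a ⇀ (⊤ : Q) ↔ spp x ≤ a := by
  constructor
  · intro h
    refine (spp_mono A h).trans ?_
    rw [spp_lres]
    exact inf_le_left
  · intro h
    rw [← spp_lres_self (A := A) x]
    exact lres_mono h le_top

theorem spp_mul_le (x y : Q) : (spp (x * y) : A) ≤ spp x := by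
  have h : x * y = (spp x : A) ⇀ (x * y) := by rw [← lres_mul, spp_lres_self]
  rw [h, spp_lres]
  exact inf_le_left

theorem spp_rres_le (x y : Q) : (spp (x ↼ (spp y : A)) : A) ≤ spp (x * y) := by
  have hm := isBimorphism_mul A Q
  have h1 : ∀ z : Q, z ≤ z * ⊤ := fun z => by
    conv_lhs => rw [← spp_lres_self (A := A) z]
    refine (spp_lres_le z z).trans ?_
    rw [mul_assoc]
    exact hm.mono le_rfl le_top
  have h2 : (x ↼ (spp y : A)) * ⊤ ≤ x * y * ⊤ := by
    rw [rres_mul, mul_assoc]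
    refine hm.mono le_rfl ((spp_lres_le y ⊤).trans ?_)
    rw [mul_assoc]
    exact hm.mono le_rfl le_top
  exact (spp_mono A (h1 _)).trans ((spp_mono A h2).trans (spp_mul_le _ _))

theorem star_lres (a : A) (x : Q) : star (a ⇀ x) = star x ↼ a := by
  have := star_lres_rres a ⊤ x
  rwa [rres_top, top_lres] at this

theorem star_rres (a : A) (x : Q) : star (x ↼ a) = a ⇀ star x := by
  have := star_lres_rres ⊤ a x
  rwa [rres_top, top_lres] at this

theorem star_le_iff (A : Type u) [Order.Frame A] [GroupoidQuantale A Q] {x y : Q} :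
    star x ≤ y ↔ x ≤ star y :=
  ⟨fun h => by simpa using star_mono A h, fun h => by simpa using star_mono A h⟩

theorem comul_lres_top (a : A) : comulHom A Q (a ⇀ ⊤) = inl A Q Q (a ⇀ ⊤) := by
  have hm := isBimorphism_mul A Q
  apply le_antisymm
  · rintro ⟨x, y⟩ h
    have h1 : x * y ≤ a ⇀ (⊤ : Q) := hm.mem_adj.1 h
    have h2 : x ↼ (spp y : A) ≤ a ⇀ (⊤ : Q) :=
      (le_lres_top_iff _ _).2 ((spp_rres_le x y).trans ((le_lres_top_iff _ _).1 h1))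
    have h3 : (x ↼ (spp y : A), y) ∈ inl A Q Q (a ⇀ ⊤) :=
      Tensor.lower _ h2 le_top (mem_tmul _ _)
    have h4 := (Tensor.balanced _ _ _ _).1 h3
    rwa [spp_lres_self] at h4
  · refine tmul_le.2 (hm.mem_adj.2 ?_)
    rw [lres_mul]
    exact lres_mono le_rfl le_top

theorem comul_top_rres (a : A) : comulHom A Q (⊤ ↼ a) = inr A Q Q (⊤ ↼ a) := by
  have hm := isBimorphism_mul A Q
  have ht : star (⊤ : Q) = ⊤ := map_top (starHom A Q)
  apply le_antisymm
  · rintro ⟨x, y⟩ h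
    have h1 : x * y ≤ (⊤ : Q) ↼ a := hm.mem_adj.1 h
    have h1' : star y * star x ≤ a ⇀ (⊤ : Q) := by
      rw [← star_mul, star_le_iff A, star_lres, ht]
      exact h1
    have h2 : star y ↼ (spp (star x) : A) ≤ a ⇀ (⊤ : Q) :=
      (le_lres_top_iff _ _).2 ((spp_rres_le _ _).trans ((le_lres_top_iff _ _).1 h1'))
    have h2' : (spp (star x) : A) ⇀ y ≤ (⊤ : Q) ↼ a := by
      have h := star_mono A h2
      rwa [star_rres, star_star, star_lres, ht] at h
    have h3 : (x, (spp (star x) : A) ⇀ y) ∈ inr A Q Q (⊤ ↼ a) :=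
      Tensor.lower _ le_top h2' (mem_tmul _ _)
    have h4 := (Tensor.balanced _ _ _ _).2 h3
    have h5 : x ↼ (spp (star x) : A) = x := by
      have h := congrArg star (spp_lres_self (A := A) (star x))
      rwa [star_lres, star_star] at h
    rwa [h5] at h4
  · refine tmul_le.2 (hm.mem_adj.2 ?_)
    rw [← mul_rres, ← inf_top_rres]
    exact inf_le_right

theorem rightUnit_aux (q : Q) :
    ⨆ (x : Q) (y : Q) (_ : x * y ≤ q), x ↼ (υ (star y) : A) = q := by
  have h := congrArg (starHom A Q) (unit_laws (A := A) (star q))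
  simp only [map_iSup] at h
  have e : ∀ x y : Q, starHom A Q ((υ x : A) ⇀ y) = star y ↼ (υ x : A) := fun x y => star_lres _ _
  have e' : starHom A Q (star q) = q := star_star q
  simp only [e, e'] at h
  conv_rhs => rw [← h]
  apply le_antisymm
  · refine iSup_le fun x => iSup_le fun y => iSup_le fun h => ?_
    refine le_iSup_of_le (star y) (le_iSup_of_le (star x) (le_iSup_of_le ?_ ?_))
    · rw [← star_mul]; exact star_mono A h
    · rw [star_star]
  · refine iSup_le fun x => iSup_le fun y => iSup_le fun h => ?_
    refine le_iSup_of_le (star y) (le_iSup_of_le (star x) (le_iSup_of_le ?_ ?_))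
    · rw [← star_mul, star_le_iff A]; exact h
    · rw [star_star]

theorem υ_lres (a : A) (x : Q) : (υ (a ⇀ x) : A) = a ⊓ υ x := by
  rw [← lres_top_inf, map_inf, υ_lres_top]

theorem υ_rres (a : A) (x : Q) : (υ (x ↼ a) : A) = υ x ⊓ a := by
  rw [← inf_top_rres, map_inf, υ_top_rres]

theorem υ_star (q : Q) : (υ (star q) : A) = υ q := by
  have h1 : (υ (star q) : A) = ⨆ (x : Q) (y : Q) (_ : x * y ≤ q), υ x ⊓ υ (star y) := by
    have h := congrArg (fun z => (υ (starHom A Q z) : A)) (unit_laws (A := A) q)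
    simp only [map_iSup] at h
    refine Eq.trans h.symm ?_
    refine iSup_congr fun x => iSup_congr fun y => iSup_congr fun _ => ?_
    refine (congrArg (υ : FrameHom Q A) (star_lres _ _)).trans ?_
    rw [υ_rres, inf_comm]
  have h2 : (υ q : A) = ⨆ (x : Q) (y : Q) (_ : x * y ≤ q), υ x ⊓ υ (star y) := by
    have h := congrArg (υ : FrameHom Q A) (rightUnit_aux (A := A) q)
    simp only [map_iSup, υ_rres] at h
    exact h.symm
  rw [h1, h2]

theorem rightUnit (q : Q) :
    ⨆ (x : Q) (y : Q) (_ : x * y ≤ q), x ⊓ ((⊤ : Q) ↼ (υ y : A)) = q := by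
  simpa only [υ_star, inf_top_rres] using rightUnit_aux (A := A) q

theorem leftUnit (q : Q) :
    ⨆ (x : Q) (y : Q) (_ : x * y ≤ q), ((υ x : A) ⇀ (⊤ : Q)) ⊓ y = q := by
  simpa only [lres_top_inf] using unit_laws (A := A) q

theorem star_lres_top (a : A) : star (a ⇀ (⊤ : Q)) = ⊤ ↼ a :=
  (star_lres a ⊤).trans (congrArg (· ↼ a) (map_top (starHom A Q)))

theorem star_top_rres (a : A) : star ((⊤ : Q) ↼ a) = a ⇀ ⊤ :=
  (star_rres a ⊤).trans (congrArg (a ⇀ ·) (map_top (starHom A Q)))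

theorem mulInv (q : Q) :
    ⨆ (x : Q) (y : Q) (_ : x * y ≤ q), x ⊓ star y = (υ q : A) ⇀ (⊤ : Q) := by
  have hm := isBimorphism_mul A Q
  rw [inverse_laws]
  apply le_antisymm
  · refine iSup_le fun x => iSup_le fun y => iSup_le fun h => ?_
    refine le_iSup₂_of_le (x ⊓ star y) ?_ le_rfl
    exact (hm.mono inf_le_left ((star_le_iff A).2 inf_le_right)).trans h
  · refine iSup₂_le fun x h => ?_
    refine le_iSup_of_le x (le_iSup_of_le (star x) (le_iSup_of_le h ?_))
    rw [star_star, inf_idem]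

theorem invMul (q : Q) :
    ⨆ (x : Q) (y : Q) (_ : x * y ≤ q), star x ⊓ y = (⊤ : Q) ↼ (υ q : A) := by
  have hm := isBimorphism_mul A Q
  have ht : star (⊤ : Q) = ⊤ := map_top (starHom A Q)
  have e : (⊤ : Q) ↼ (υ q : A) = star ((υ q : A) ⇀ (⊤ : Q)) := by rw [star_lres, ht]
  apply le_antisymm
  · refine iSup_le fun x => iSup_le fun y => iSup_le fun h => ?_
    rw [e, ← star_le_iff A, inverse_laws]
    refine le_iSup₂_of_le (star (star x ⊓ y)) ?_ le_rfl
    rw [star_star]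
    exact (hm.mono ((star_le_iff A).2 inf_le_left) inf_le_right).trans h
  · rw [e, star_le_iff A, inverse_laws]
    refine iSup₂_le fun x h => ?_
    rw [← star_le_iff A]
    refine le_iSup_of_le x (le_iSup_of_le (star x) (le_iSup_of_le h ?_))
    rw [inf_idem]

theorem assoc_aux {Q N T : Type u} [CompleteLattice Q] [Semigroup Q] [CompleteLattice N] [Order.Frame T] (act : Q → N → N)
    (hmono : ∀ {q q' n n'}, q' ≤ q → n' ≤ n → act q' n' ≤ act q n)
    (hassoc : ∀ q q' n, act (q * q') n = act q (act q' n))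
    (g h : Q → T) (k : N → T) (c : N) :
    ⨆ (x : Q) (n : N) (_ : act x n ≤ c), (⨆ (z : Q) (w : Q) (_ : z * w ≤ x), g z ⊓ h w) ⊓ k n =
    ⨆ (x : Q) (n : N) (_ : act x n ≤ c), g x ⊓ ⨆ (z : Q) (w : N) (_ : act z w ≤ n), h z ⊓ k w := by
  simp only [iSup_inf_eq, inf_iSup_eq]
  apply le_antisymm
  · refine iSup_le fun x => iSup_le fun n => iSup_le fun hc => iSup_le fun z => iSup_le fun w =>
      iSup_le fun hx => ?_
    refine le_iSup_of_le z (le_iSup_of_le (act w n) (le_iSup_of_le ?_ (le_iSup_of_le w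
      (le_iSup_of_le n (le_iSup_of_le le_rfl (inf_assoc _ _ _).le)))))
    rw [← hassoc]
    exact (hmono hx le_rfl).trans hc
  · refine iSup_le fun x => iSup_le fun n => iSup_le fun hc => iSup_le fun z => iSup_le fun w =>
      iSup_le fun hx => ?_
    refine le_iSup_of_le (x * z) (le_iSup_of_le w (le_iSup_of_le ?_ (le_iSup_of_le x
      (le_iSup_of_le z (le_iSup_of_le le_rfl (inf_assoc _ _ _).ge)))))
    rw [hassoc]
    exact (hmono le_rfl hx).trans hc

theorem lift_assoc {A Q N : Type u} [Order.Frame A] [Order.Frame Q] [Order.Frame N] [Semigroup Q]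
    [RightAModule A Q] [LeftAModule A Q] [LeftAModule A N] [RightLocalic A Q] [LeftLocalic A Q]
    [LeftLocalic A N] {act : Q → N → N}
    {f p : Locale.of Q ⟶ Locale.of A} {f' : Locale.of Q ⟶ Locale.of A}
    {p' : Locale.of N ⟶ Locale.of A}
    (hQ : IsPullback (proj₁ A Q Q) (proj₂ A Q Q) f p)
    (hN : IsPullback (proj₁ A Q N) (proj₂ A Q N) f' p')
    (hmul : IsBimorphism A (fun x y : Q => x * y)) (hact : IsBimorphism A act)
    {μ : FrameHom Q (Tensor A Q Q)} {ν : FrameHom N (Tensor A Q N)}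
    (hμ : ∀ q, μ q = adj A (fun x y : Q => x * y) q) (hν : ∀ n, ν n = adj A act n)
    (hassoc : ∀ q q' n, act (q * q') n = act q (act q' n))
    {T : Locale.{u}} (g h : T ⟶ Locale.of Q) (k : T ⟶ Locale.of N) (w₁ : g ≫ f = h ≫ p)
    (w₂ : (hQ.lift g h w₁ ≫ mapOf μ) ≫ f' = k ≫ p') (w₃ : h ≫ f' = k ≫ p')
    (w₄ : g ≫ f' = (hN.lift h k w₃ ≫ mapOf ν) ≫ p') :
    hN.lift (hQ.lift g h w₁ ≫ mapOf μ) k w₂ ≫ mapOf ν =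
      hN.lift g (hN.lift h k w₃ ≫ mapOf ν) w₄ ≫ mapOf ν := by
  refine mapOf_ext fun c => ?_
  refine (frameHom_lift_comp hN _ _ w₂ hact hν c).trans ?_
  refine Eq.trans ?_ (frameHom_lift_comp hN _ _ w₄ hact hν c).symm
  have e1 := frameHom_lift_comp hQ g h w₁ hmul hμ
  have e2 := frameHom_lift_comp hN h k w₃ hact hν
  refine Eq.trans ?_ ((assoc_aux act hact.mono hassoc (frameHom g) (frameHom h) (frameHom k)
    c).trans ?_)
  · exact iSup_congr fun x => iSup_congr fun y => iSup_congr fun _ => congrArg (· ⊓ _) (e1 x)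
  · exact iSup_congr fun x => iSup_congr fun y => iSup_congr fun _ => congrArg (_ ⊓ ·) (e2 y).symm

/-- The localic groupoid `𝒢(Q)` of a groupoid quantale `Q` over `A`: the locale of objects is
`A`, the locale of arrows is `Q`, and the inverse images of the structure maps are
`d^* a = a ⇀ 1`, `r^* a = 1 ↼ a`, `u^* = υ`, `i^* = star`, and `m^*` is the right adjoint of the
multiplication `Q ⊗_A Q → Q`. -/
def groupoidOf (A Q : Type u) [Order.Frame A] [Order.Frame Q] [Semigroup Q] [IsQuantale Q]
    [StarMul Q] [GroupoidQuantale A Q] : LocalicGroupoid.{u} where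
  obj := Locale.of A
  arr := Locale.of Q
  comp := prod A Q Q
  d := mapOf (lresTop A Q)
  r := mapOf (topRres A Q)
  unit := mapOf (υ : FrameHom Q A)
  i := mapOf (starHom A Q)
  π₁ := proj₁ A Q Q
  π₂ := proj₂ A Q Q
  m := mapOf (comulHom A Q)
  isPullback := Tensor.isPullback (fun _ => rfl) (fun _ => rfl)
  unit_d := mapOf_ext (Q := A) fun a => υ_lres_top (Q := Q) a
  unit_r := mapOf_ext (Q := A) fun a => υ_top_rres (Q := Q) a
  m_d := mapOf_ext fun a => comul_lres_top a
  m_r := mapOf_ext fun a => comul_top_rres a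
  assoc _ g h k _ _ :=
    lift_assoc _ _ (isBimorphism_mul A Q) (isBimorphism_mul A Q) (fun _ => rfl) (fun _ => rfl)
      mul_assoc g h k _ _ _ _
  unit_mul := mapOf_ext fun q =>
    (frameHom_lift_comp _ _ _ _ (isBimorphism_mul A Q) (fun _ => rfl) q).trans (leftUnit q)
  mul_unit := mapOf_ext fun q =>
    (frameHom_lift_comp _ _ _ _ (isBimorphism_mul A Q) (fun _ => rfl) q).trans (rightUnit q)
  i_d := mapOf_ext fun a => star_lres_top (A := A) (Q := Q) a
  i_r := mapOf_ext fun a => star_top_rres (A := A) (Q := Q) a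
  mul_inv := mapOf_ext fun q =>
    (frameHom_lift_comp _ _ _ _ (isBimorphism_mul A Q) (fun _ => rfl) q).trans (mulInv q)
  inv_mul := mapOf_ext fun q =>
    (frameHom_lift_comp _ _ _ _ (isBimorphism_mul A Q) (fun _ => rfl) q).trans (invMul q)

theorem groupoidOf_isOpen (A Q : Type u) [Order.Frame A] [Order.Frame Q] [Semigroup Q]
    [IsQuantale Q] [StarMul Q] [GroupoidQuantale A Q] : (groupoidOf A Q).IsOpen := by
  have gc : GaloisConnection (spp : Q → A) (lresTop A Q) := fun x a => (le_lres_top_iff x a).symm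
  have h : ∀ (x : Q) (a : A), (spp (x ⊓ (a ⇀ (⊤ : Q))) : A) = spp x ⊓ a := fun x a => by
    rw [inf_comm x, lres_top_inf, spp_lres, inf_comm]
  exact ⟨(spp : Q → A), gc, h⟩

end GroupoidOf

/-! ## Modules over groupoid quantales -/

/-- A (left) `Q`-module, for a groupoid quantale `Q` over `A`: a locale `X` with an associative left
action of `Q` (Mathlib's `SemigroupAction`, written `q • x`) that preserves joins in each variable,
and a unital left `A`-module structure (whose compatibility with meets is the parent
`LeftLocalic`). -/
class QModule (A Q X : Type u) [Order.Frame A] [Order.Frame Q] [Semigroup Q] [IsQuantale Q]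
    [StarMul Q] [GroupoidQuantale A Q] [Order.Frame X] [SemigroupAction Q X]
    extends LeftAModule A X, LeftLocalic A X where
  sSup_smul : ∀ (S : Set Q) (x : X), sSup S • x = ⨆ q ∈ S, q • x
  smul_sSup : ∀ (q : Q) (S : Set X), q • sSup S = ⨆ x ∈ S, q • x
  lres_smul : ∀ (a : A) (q : Q) (x : X), (a ⇀ q) • x = a ⇀ (q • x)
  rres_smul : ∀ (a : A) (q : Q) (x : X), (q ↼ a) • x = q • (a ⇀ x)

/-- A pre-Hilbert `Q`-module: a `Q`-module with a `Q`-valued inner product `ip`. -/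
class PreHilbertQModule (A Q X : Type u) [Order.Frame A] [Order.Frame Q] [Semigroup Q]
    [IsQuantale Q] [StarMul Q] [GroupoidQuantale A Q] [Order.Frame X] [SemigroupAction Q X]
    extends QModule A Q X where
  ip : X → X → Q
  ip_smul : ∀ (q : Q) (x y : X), ip (q • x) y = q * ip x y
  lres_ip_top : ∀ (a : A) (x : X), a ⇀ ip x ⊤ = ip (a ⇀ x) ⊤
  sSup_ip : ∀ (S : Set X) (y : X), ip (sSup S) y = ⨆ x ∈ S, ip x y
  ip_symm : ∀ x y : X, ip x y = star (ip y x)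

/-- A supported `Q`-module, with support `sppX : X → A`. -/
class SupportedQModule (A Q X : Type u) [Order.Frame A] [Order.Frame Q] [Semigroup Q]
    [IsQuantale Q] [StarMul Q] [GroupoidQuantale A Q] [Order.Frame X] [SemigroupAction Q X]
    extends PreHilbertQModule A Q X where
  sppX : X → A
  sppX_mono : Monotone sppX
  sppX_top : sppX ⊤ = ⊤
  sppX_lres_top_le : ∀ x : X, sppX x ⇀ (⊤ : X) ≤ ip x x • (⊤ : X)
  sppX_lres_self : ∀ x : X, sppX x ⇀ x = x

/-- The module action `α : Q ⊗_A X → X`, `q ⊗ x ↦ q • x`, of a `Q`-module. -/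
def moduleAction (A Q X : Type u) [Order.Frame A] [Order.Frame Q] [Semigroup Q] [IsQuantale Q]
    [StarMul Q] [GroupoidQuantale A Q] [Order.Frame X] [SemigroupAction Q X] [QModule A Q X] :
    Tensor A Q X → X :=
  Tensor.lift fun (q : Q) (x : X) => q • x

/-- The map `α_* : X → Q ⊗_A X`, `α_* x = ⋁ {q ⊗ y | q • y ≤ x}`, of a `Q`-module. -/
def moduleCoaction (A Q X : Type u) [Order.Frame A] [Order.Frame Q] [Semigroup Q] [IsQuantale Q]
    [StarMul Q] [GroupoidQuantale A Q] [Order.Frame X] [SemigroupAction Q X] [QModule A Q X] :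
    X → Tensor A Q X :=
  Tensor.adj A fun (q : Q) (x : X) => q • x

theorem isBimorphism_smul (A Q X : Type u) [Order.Frame A] [Order.Frame Q] [Semigroup Q]
    [IsQuantale Q] [StarMul Q] [GroupoidQuantale A Q] [Order.Frame X] [SemigroupAction Q X]
    [QModule A Q X] : Tensor.IsBimorphism A fun (q : Q) (x : X) => q • x where
  sSup_left := QModule.sSup_smul A
  sSup_right := QModule.smul_sSup A
  balanced q a x := QModule.rres_smul a q x

/-- `α_*` is the right adjoint of `α`. -/
theorem gc_moduleAction (A Q X : Type u) [Order.Frame A] [Order.Frame Q] [Semigroup Q]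
    [IsQuantale Q] [StarMul Q] [GroupoidQuantale A Q] [Order.Frame X] [SemigroupAction Q X]
    [QModule A Q X] : GaloisConnection (moduleAction A Q X) (moduleCoaction A Q X) :=
  (isBimorphism_smul A Q X).gc

/-- A `Q`-locale: a stably supported `Q`-module such that the right adjoint
`x ↦ ⋁ {q ⊗ y | q • y ≤ x}` of the module action `Q ⊗_A X → X` preserves joins, and the unit law
`⋁ {υ q ⇀ y | q • y ≤ x} = x` holds. -/
class QLocale (A Q X : Type u) [Order.Frame A] [Order.Frame Q] [Semigroup Q]
    [IsQuantale Q] [StarMul Q] [GroupoidQuantale A Q] [Order.Frame X] [SemigroupAction Q X]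
    extends SupportedQModule A Q X where
  sppX_smul_le : ∀ (q : Q) (x : X), sppX (q • x) ≤ SupportedQuantale.spp q
  multiplicative : ∀ S : Set X, moduleCoaction A Q X (sSup S) = ⨆ x ∈ S, moduleCoaction A Q X x
  unit_laws : ∀ x : X,
    ⨆ (q : Q) (y : X) (_ : q • y ≤ x), (GroupoidQuantale.υ q : A) ⇀ y = x

end OpenGpd

namespace OpenGpd

section QLocale

open Tensor SupportedQuantale GroupoidQuantale BasedQuantale LeftAModule RightAModule LeftLocalic
  RightLocalic QModule PreHilbertQModule SupportedQModule

variable {A Q X : Type u} [Order.Frame A] [Order.Frame Q] [Semigroup Q] [IsQuantale Q] [StarMul Q]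
  [GroupoidQuantale A Q] [Order.Frame X] [SemigroupAction Q X] [QLocale A Q X]

/-! The anchor map is given by `p^* a = a ⇀ ⊤` and the action by `𝔞^* = α_*`. The latter is a frame
homomorphism: as a right adjoint it preserves finite meets, and joins are preserved by the
multiplicativity axiom. The pullback property of `Q ⊗_A X` is the general one for tensor products
over `A`. What remains is that `p` is an open surjection with direct image `sppX`, and that `𝔞`
satisfies the laws of an action.

The crux is the identity `sppX x = spp ⟨x, ⊤⟩` (`sppX_eq_spp_ip`). The axioms make `sppX` merely
monotone and say nothing of how it meets the action of `A`, whereas `x ↦ spp ⟨x, ⊤⟩` inherits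
equivariance from the support of `Q`. Stability, `sppX (q • x) ≤ spp q`, together with `sppX x ⇀ ⊤ ≤
⟨x, x⟩ • ⊤`, forces the two to agree. Hence `sppX` is equivariant, which is the Frobenius condition
for `p`; it is left adjoint to `p^*` because `sppX (a ⇀ ⊤) = a`, and `p^*` is injective because `spp
⟨a ⇀ ⊤, ⊤⟩ = a`.

The law `p ∘ 𝔞 = d ∘ π₁` becomes `α_* (a ⇀ ⊤) = (a ⇀ ⊤) ⊗ ⊤` (`coaction_lres_top`). Its hard half
moves the support of `x` across the tensor, `q ⊗ x = (q ↼ sppX x) ⊗ x`, and bounds the support of `q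
↼ sppX x` by that of `q • x`. For associativity and the unit law, inverse images of maps built from
`𝔞` expand into joins indexed by pairs with `q • y ≤ x`; these laws then reduce to associativity of
the module action and to the unit axiom of a `Q`-locale. -/

theorem ip_mono_left (A : Type u) [Order.Frame A] [GroupoidQuantale A Q] [PreHilbertQModule A Q X]
    {x x' : X} (y : X) (h : x ≤ x') : (ip A x y : Q) ≤ ip A x' y := by
  have : (ip A x' y : Q) = ⨆ z ∈ ({x, x'} : Set X), ip A z y := by
    rw [← sSup_ip, sSup_pair, sup_eq_right.2 h]
  rw [this]
  exact le_iSup₂ (f := fun z (_ : z ∈ ({x, x'} : Set X)) => (ip A z y : Q)) x (by simp)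

/-- Joins are assumed only in the first variable; the symmetry of the inner product transfers
monotonicity to the second. -/
theorem ip_mono_right (A : Type u) [Order.Frame A] [GroupoidQuantale A Q] [PreHilbertQModule A Q X]
    (x : X) {y y' : X} (h : y ≤ y') : (ip A x y : Q) ≤ ip A x y' := by
  rw [ip_symm x y, ip_symm x y']
  exact star_mono A (ip_mono_left A x h)

/-! ### The support of `X` expressed through the inner product -/

/-- This allows `a ⇀ ⊤` in `X` to be rewritten as `(a ⇀ ⊤) • ⊤`, with the restriction taken in `Q`,
so that stability applies to it. -/
theorem top_smul_top (A Q X : Type u) [Order.Frame A] [Order.Frame Q] [Semigroup Q] [IsQuantale Q]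
    [StarMul Q] [GroupoidQuantale A Q] [Order.Frame X] [SemigroupAction Q X]
    [SupportedQModule A Q X] : (⊤ : Q) • (⊤ : X) = ⊤ := by
  -- At `⊤`, whose support is `⊤`, the axiom reads `⊤ ≤ ⟨⊤, ⊤⟩ • ⊤`.
  have h := sppX_lres_top_le (A := A) (Q := Q) (⊤ : X)
  rw [sppX_top, top_lres] at h
  exact top_le_iff.1 (h.trans ((isBimorphism_smul A Q X).mono le_top le_rfl))

theorem sppX_lres_top_le_self (a : A) : sppX Q (a ⇀ (⊤ : X)) ≤ a := by
  rw [← top_smul_top A Q X, ← lres_smul]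
  refine (QLocale.sppX_smul_le _ _).trans ?_
  rw [spp_lres]
  exact inf_le_left

/-- Since `⊤ ≤ ⟨⊤, ⊤⟩ • ⊤`, stability bounds `sppX ⊤ = ⊤` by the support of `⟨⊤, ⊤⟩`. This is what
makes the anchor map a surjection. -/
theorem spp_ip_top_top : (spp (ip A (⊤ : X) (⊤ : X) : Q) : A) = ⊤ := by
  have h := sppX_mono (A := A) (Q := Q) (sppX_lres_top_le (A := A) (Q := Q) (⊤ : X))
  rw [sppX_top, top_lres, sppX_top] at h
  exact top_le_iff.1 (h.trans (QLocale.sppX_smul_le _ _))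

/-- The axiom on restricting `⟨x, ⊤⟩` reduces equivariance in `X` to equivariance of the support of
`Q`. -/
theorem spp_ip_lres_top (a : A) (x : X) :
    (spp (ip A (a ⇀ x) (⊤ : X) : Q) : A) = a ⊓ spp (ip A x (⊤ : X) : Q) := by
  rw [← lres_ip_top, spp_lres]

/-- The inverse image of the anchor map of a `Q`-locale is injective. -/
theorem lres_top_injective (A Q X : Type u) [Order.Frame A] [Order.Frame Q] [Semigroup Q]
    [IsQuantale Q] [StarMul Q] [GroupoidQuantale A Q] [Order.Frame X] [SemigroupAction Q X]
    [QLocale A Q X] : Function.Injective fun a : A => a ⇀ (⊤ : X) := by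
  intro a b h
  -- The map `x ↦ spp ⟨x, ⊤⟩` is a left inverse: it sends `a ⇀ ⊤` to `a ⊓ spp ⟨⊤, ⊤⟩ = a`.
  have h' := congrArg (fun x => (spp (ip A x (⊤ : X) : Q) : A)) h
  simpa only [spp_ip_lres_top, spp_ip_top_top, inf_top_eq] using h'

/-- Only `≤` follows directly from stability. For equality, both sides are shown to restrict `⊤` to
the same element, and the injectivity of `p^*` is used. -/
theorem sppX_lres_top (a : A) : sppX Q (a ⇀ (⊤ : X)) = a := by
  apply lres_top_injective A Q X
  change _ ⇀ _ = _ ⇀ _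
  apply le_antisymm (lres_mono (sppX_lres_top_le_self a) le_rfl)
  -- An element is fixed by restriction to its own support, hence lies below the restriction of `⊤`
  -- to that support.
  conv_lhs => rw [← sppX_lres_self (A := A) (Q := Q) (a ⇀ (⊤ : X))]
  exact lres_mono le_rfl le_top

/-- Upper bound: apply `sppX` to `sppX x ⇀ ⊤ ≤ ⟨x, x⟩ • ⊤`, use stability, and enlarge `⟨x, x⟩` to
`⟨x, ⊤⟩`. Lower bound: write `x = sppX x ⇀ x` and use equivariance of `spp ⟨-, ⊤⟩`. -/
theorem sppX_eq_spp_ip (x : X) : sppX Q x = (spp (ip A x (⊤ : X) : Q) : A) := by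
  apply le_antisymm
  · have h := sppX_mono (A := A) (Q := Q) (sppX_lres_top_le (A := A) (Q := Q) x)
    rw [sppX_lres_top] at h
    exact h.trans ((QLocale.sppX_smul_le _ _).trans (spp_mono A (ip_mono_right A x le_top)))
  · conv_lhs => rw [← sppX_lres_self (A := A) (Q := Q) x]
    rw [spp_ip_lres_top]
    exact inf_le_left

theorem sppX_lres (a : A) (x : X) : sppX Q (a ⇀ x) = a ⊓ sppX Q x := by
  rw [sppX_eq_spp_ip, sppX_eq_spp_ip, spp_ip_lres_top]

/-- The unit of the adjunction is `x = sppX x ⇀ x ≤ sppX x ⇀ ⊤`; the counit is the equality `sppX (a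
⇀ ⊤) = a`. -/
theorem gc_sppX (A Q X : Type u) [Order.Frame A] [Order.Frame Q] [Semigroup Q]
    [IsQuantale Q] [StarMul Q] [GroupoidQuantale A Q] [Order.Frame X] [SemigroupAction Q X]
    [QLocale A Q X] : GaloisConnection (sppX Q : X → A) (lresTop A X) := by
  intro x a
  constructor
  · intro h
    rw [← sppX_lres_self (A := A) (Q := Q) x]
    exact lres_mono h le_top
  · intro h
    exact (sppX_mono h).trans (sppX_lres_top a).le

/-! ### The coaction and its compatibility with the anchor map -/

/-- With supports written as `spp ⟨-, ⊤⟩` and `⟨q • x, ⊤⟩ = q * ⟨x, ⊤⟩`, this is the corresponding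
inequality for products in `Q`. -/
theorem spp_rres_sppX_le (q : Q) (x : X) :
    (spp (q ↼ (sppX Q x : A)) : A) ≤ sppX Q (q • x) := by
  rw [sppX_eq_spp_ip, sppX_eq_spp_ip, ip_smul]
  exact spp_rres_le _ _

/-- The right adjoint of the module action `Q ⊗_A X → X`, as a frame homomorphism. -/
def coactionHom (A Q X : Type u) [Order.Frame A] [Order.Frame Q] [Semigroup Q] [IsQuantale Q]
    [StarMul Q] [GroupoidQuantale A Q] [Order.Frame X] [SemigroupAction Q X] [QLocale A Q X] :
    FrameHom X (Tensor A Q X) where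
  toFun := moduleCoaction A Q X
  map_inf' _ _ := (gc_moduleAction A Q X).u_inf
  map_top' := (gc_moduleAction A Q X).u_top
  map_sSup' S := by rw [QLocale.multiplicative, sSup_image]

/-- This is `p ∘ 𝔞 = d ∘ π₁` on inverse images. The inclusion from left to right is the substantial
one, as `q • x ≤ a ⇀ ⊤` does not by itself bound `q`, only its restriction to the support of `x`. -/
theorem coaction_lres_top (a : A) :
    coactionHom A Q X (a ⇀ ⊤) = inl A Q X (a ⇀ ⊤) := by
  have hα := isBimorphism_smul A Q X
  apply le_antisymm
  · rintro ⟨q, x⟩ h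
    have h1 : q • x ≤ a ⇀ (⊤ : X) := hα.mem_adj.1 h
    have h2 : q ↼ (sppX Q x : A) ≤ a ⇀ (⊤ : Q) :=
      (le_lres_top_iff _ _).2 ((spp_rres_sppX_le q x).trans ((gc_sppX A Q X).l_le h1))
    have h3 : (q ↼ (sppX Q x : A), x) ∈ inl A Q X (a ⇀ ⊤) :=
      Tensor.lower _ h2 le_top (mem_tmul _ _)
    -- Balancedness moves `sppX x` from the right of `q` to the left of `x`, where it acts
    -- trivially.
    have h4 := (Tensor.balanced _ _ _ _).1 h3
    rwa [sppX_lres_self] at h4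
  · refine tmul_le.2 (hα.mem_adj.2 ?_)
    rw [lres_smul]
    exact lres_mono le_rfl le_top

theorem leftUnit_smul (x : X) :
    ⨆ (q : Q) (y : X) (_ : q • y ≤ x), ((υ q : A) ⇀ (⊤ : X)) ⊓ y = x := by
  simpa only [lres_top_inf] using QLocale.unit_laws (A := A) (Q := Q) x

/-- The anchor map of a `Q`-locale is open. -/
theorem isOpenLocaleMap_lresTop (A Q X : Type u) [Order.Frame A] [Order.Frame Q] [Semigroup Q]
    [IsQuantale Q] [StarMul Q] [GroupoidQuantale A Q] [Order.Frame X] [SemigroupAction Q X]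
    [QLocale A Q X] : IsOpenLocaleMap (mapOf (lresTop A X)) := by
  have h : ∀ (x : X) (a : A), sppX Q (x ⊓ (a ⇀ (⊤ : X))) = sppX Q x ⊓ a := fun x a => by
    rw [inf_comm x, lres_top_inf, sppX_lres, inf_comm]
  exact ⟨(sppX Q : X → A), gc_sppX A Q X, h⟩

/-! ### The laws of an action -/

theorem isGLocale_of_qLocale (A Q X : Type u) [Order.Frame A] [Order.Frame Q] [Semigroup Q]
    [IsQuantale Q] [StarMul Q] [GroupoidQuantale A Q] [Order.Frame X] [SemigroupAction Q X]
    [QLocale A Q X] :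
    IsGLocale (groupoidOf A Q) (proj₁ A Q X) (proj₂ A Q X) (mapOf (lresTop A X))
      (mapOf (coactionHom A Q X)) where
  isPullback := Tensor.isPullback (fun _ => rfl) (fun _ => rfl)
  act_p := mapOf_ext fun a => coaction_lres_top a
  assoc _ g h x _ _ :=
    -- The same lemma gives associativity of the groupoid multiplication; here the second bimorphism
    -- is the module action.
    (lift_assoc _ _ (isBimorphism_mul A Q) (isBimorphism_smul A Q X) (fun _ => rfl) (fun _ => rfl)
      mul_smul g h x _ _ _ _).symm
  unit_act := mapOf_ext fun x => by
    -- The inverse image of `u ∘ p` sends `q` to `υ q ⇀ ⊤`, so the composite sends `x` to the join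
    -- of `(υ q ⇀ ⊤) ⊓ y` over `q • y ≤ x`.
    refine (frameHom_lift_comp _ _ _ _ (isBimorphism_smul A Q X) (fun _ => rfl) x).trans ?_
    exact (leftUnit_smul (A := A) (Q := Q) x)

end QLocale

end OpenGpd

theorem mainTheorem4 {A Q X : Type u} [Order.Frame A] [Order.Frame Q] [Semigroup Q] [IsQuantale Q]
    [StarMul Q] [OpenGpd.GroupoidQuantale A Q] [Order.Frame X] [SemigroupAction Q X]
    [OpenGpd.QLocale A Q X] :
    ∃ (p : Locale.of X ⟶ Locale.of A)
      (act : OpenGpd.Tensor.prod A Q X ⟶ Locale.of X),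
      OpenGpd.IsFullyOpenGLocale (OpenGpd.groupoidOf A Q) (OpenGpd.Tensor.proj₁ A Q X)
        (OpenGpd.Tensor.proj₂ A Q X) p act ∧
      OpenGpd.IsDirectImage p (OpenGpd.SupportedQModule.sppX Q : X → A) ∧
      (∀ x : X, OpenGpd.frameHom act x = OpenGpd.moduleCoaction A Q X x) ∧
      GaloisConnection (OpenGpd.moduleAction A Q X) (OpenGpd.frameHom act) := by
  refine ⟨OpenGpd.mapOf (OpenGpd.lresTop A X), OpenGpd.mapOf (OpenGpd.coactionHom A Q X),
    { OpenGpd.isGLocale_of_qLocale A Q X with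
      isOpen := OpenGpd.isOpenLocaleMap_lresTop A Q X
      surjective := OpenGpd.lres_top_injective A Q X },
    OpenGpd.gc_sppX A Q X, fun _ => rfl, OpenGpd.gc_moduleAction A Q X⟩
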